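/- **Hub model with a null component.** There are $n$ nodes $\{1,\dots,n\}$, of which $1,\dots,n_L$ ($n_L\le n$) are the possible hubs. The parameters are a probability vector $\rho=(\rho_0,\dots,\rho_{n_L})$ and a matrix $A=(A_{ij})_{0\le i\le n_L,\,1\le j\le n}$ with entries in $[0,1]$ and $A_{ii}=1$ for $1\le i\le n_L$. Independently for $t=1,\dots,T$, a true label $z_*^{(t)}\in\{0,\dots,n_L\}$ is drawn with $\mathbb P(z_*^{(t)}=i)=\rho_i$ (the label $0$ means a hubless group), and, given $z_*^{(t)}=i$, each node $j$ belongs to group $t$ ($G^{(t)}_j=1$, otherwise $G_j^{(t)}=0$) independently with probability $A_{ij}$. For $z\in\{0,\dots,n_L\}^T$ let $$L_G(z)=\max_{B}\sum_{t=1}^T\sum_{j=1}^n\Big[G_j^{(t)}\log B_{z^{(t)}j}+(1-G_j^{(t)})\log(1-B_{z^{(t)}j})\Big]$$ be the profile log-likelihood, where $B$ runs over all $(n_L+1)\times n$ matrices with entries in $[0,1]$ and $B_{ii}=1$ for $1\le i\le n_L$ (with $\log 0=-\infty$ and $0\cdot\log 0=0$), and let $\hat z$ be a maximizer of $L_G$.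 Let $t_{i*}$ be the number of $t$ with $z_*^{(t)}=i$, and $t_{i0}$ the number of $t$ with $z_*^{(t)}=i$ and $\hat z^{(t)}=0$. **Theorem.** Let $n_L,n,T\to\infty$; all of $\rho,A,d,v$ may vary with $(n_L,n,T)$, with $d,v>0$. Assume that there are positive constants $c_{\min},c_{\max},c_0$ with $c_{\min}/n_L\le\rho_i\le c_{\max}/n_L$ for $i=0,\dots,n_L$, and that (i) for each $i=1,\dots,n_L$ there is a set $V_i\subset\{1,\dots,n\}$ with $|V_i|\ge vn/n_L$ and $A_{ij}-A_{i'j}\ge d$ for all $j\in V_i$ and all $i'\in\{0,\dots,n_L\}$, $i'\ne i$; (ii) $A_{ii'}\le c_0/n_L$ for all $i\in\{0,\dots,n_L\}$, $i'\in\{1,\dots,n_L\}$, $i\ne i'$. If $$\frac{n_L^2\log n_L}{T}=o(1),\qquad \frac{n_L^5\log T}{d^2vT}=o(1),\qquad \frac{n_L^8\log n_L}{d^4v^2n}=o(1),$$ then for every $\eta>0$, with probability tending to $1$, simultaneously for all $i=1,\dots,n_L$, $t_{i*}>0$ and $$\frac{t_{i0}}{t_{i*}}\le\eta .$$ -/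

import Mathlib

namespace HubModel

/-! Hub labels are elements of `Fin (nL + 1)`: the label `0` is the null component (hubless
groups), and the label `i.succ` is the leader `i : Fin nL`. Nodes are elements of `Fin n`; the
leaders are the first `nL` nodes, the leader `i` being the node `Fin.castLE h i`, `h : nL ≤ n`.
A data set of `T` groups is `g : Fin T → Fin n → Bool`, with `g t j = true` iff node `j` appears
in group `t`. -/

/-- The probability that a Bernoulli variable of parameter `p` takes the value `b`. -/
def bern (p : ℝ) (b : Bool) : ℝ := if b then p else 1 - p

/-- The parameter space for the matrix `A` (row `0` is the null component): all entries are
probabilities, and a hub always belongs to its own groups. -/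
def paramSpace {nL n : ℕ} (h : nL ≤ n) : Set (Matrix (Fin (nL + 1)) (Fin n) ℝ) :=
  {A | (∀ i j, A i j ∈ Set.Icc (0 : ℝ) 1) ∧ ∀ i : Fin nL, A i.succ (Fin.castLE h i) = 1}

/-- The hub model with a null component: `zs` (true hub labels) and `G` (groups) are random
variables such that the pairs `(zs t, G t)`, `t : Fin T`, are independent, `zs t` has law `ρ`, and
given `zs t = i` the nodes `j` appear independently with probabilities `A i j`. -/
structure IsHubNullModel {Ω : Type*} [MeasurableSpace Ω] (μ : MeasureTheory.Measure Ω)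
    {nL n T : ℕ} (ρ : Fin (nL + 1) → ℝ) (A : Matrix (Fin (nL + 1)) (Fin n) ℝ)
    (zs : Ω → Fin T → Fin (nL + 1)) (G : Ω → Fin T → Fin n → Bool) : Prop where
  measurable_zs : Measurable zs
  measurable_G : Measurable G
  law : ∀ (z : Fin T → Fin (nL + 1)) (g : Fin T → Fin n → Bool),
    μ.real {ω | zs ω = z ∧ G ω = g} = ∏ t, (ρ (z t) * ∏ j, bern (A (z t) j) (g t j))

/-- The log-likelihood `L_G(A | z)` of the data `g` given the labels `z`, with values in
`[-∞, 0]` for `A` in the parameter space (`log 0 = -∞`). -/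
noncomputable def logLik {nL n T : ℕ} (g : Fin T → Fin n → Bool)
    (A : Matrix (Fin (nL + 1)) (Fin n) ℝ) (z : Fin T → Fin (nL + 1)) : EReal :=
  ∑ t, ∑ j, ENNReal.log (ENNReal.ofReal (bern (A (z t) j) (g t j)))

/-- The profile log-likelihood `L_G(z)`, the maximum of `L_G(A | z)` over the parameter space. -/
noncomputable def profileLogLik {nL n T : ℕ} (h : nL ≤ n) (g : Fin T → Fin n → Bool)
    (z : Fin T → Fin (nL + 1)) : EReal :=
  ⨆ A ∈ paramSpace h, logLik g A z

/-- `z` is a maximum profile likelihood estimate of the hub labels from the data `g`. -/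
def IsProfileMLE {nL n T : ℕ} (h : nL ≤ n) (g : Fin T → Fin n → Bool)
    (z : Fin T → Fin (nL + 1)) : Prop :=
  ∀ z' : Fin T → Fin (nL + 1), profileLogLik h g z' ≤ profileLogLik h g z

/-- The number `t_{i*}` of groups whose true label is `i`. -/
def trueCount {nL T : ℕ} (zs : Fin T → Fin (nL + 1)) (i : Fin (nL + 1)) : ℕ :=
  (Finset.univ.filter fun t => zs t = i).card

/-- The number `t_{ik}` of groups with true label `i` and estimated label `k`. -/
def crossCount {nL T : ℕ} (zs zhat : Fin T → Fin (nL + 1)) (i k : Fin (nL + 1)) : ℕ :=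
  (Finset.univ.filter fun t => zs t = i ∧ zhat t = k).card

end HubModel

/-! The fitted means `fun t => B (z t)` of a maximum likelihood fit make the data at least as likely
as the true means do. The entries of `B` are empirical frequencies, so only finitely many arrays can
occur as fitted means, and a union bound in which the likelihood of the truth is dominated through
the Hellinger affinity shows that the fitted means are close to the true ones in Frobenius norm.
Since the rows of `A` are separated, no estimated class can then receive many groups from two
different true classes.

On the other hand, an estimate uses the label of a hub only for groups containing that hub, and each
hub is absent from a positive fraction of the groups of every other class. So every true class sends
many groups to some estimated class, and to a second one if the first is a wrong non-null class.
The relation of sending many groups is therefore the graph of a permutation under which each class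
goes to itself or to the null class, and the only such permutation is the identity. -/

namespace HubModel

open Finset MeasureTheory Filter Topology

section Bernoulli

variable {ι κ K : Type*} [Fintype ι] [Fintype κ] [Fintype K]

lemma bern_nonneg {p : ℝ} (hp : p ∈ Set.Icc (0 : ℝ) 1) (b : Bool) : 0 ≤ bern p b := by
  cases b
  · simpa [bern] using hp.2
  · simpa [bern] using hp.1

lemma sum_bern (p : ℝ) : ∑ b, bern p b = 1 := by
  simp [bern]

lemma prod_bern_nonneg {p : κ → ℝ} (hp : ∀ j, p j ∈ Set.Icc (0 : ℝ) 1) (x : κ → Bool) :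
    0 ≤ ∏ j, bern (p j) (x j) :=
  prod_nonneg fun j _ => bern_nonneg (hp j) _

lemma sum_prod_bern [DecidableEq κ] (p : κ → ℝ) : ∑ x : κ → Bool, ∏ j, bern (p j) (x j) = 1 := by
  rw [← Fintype.prod_sum fun j b => bern (p j) b]
  exact prod_eq_one fun j _ => sum_bern (p j)

lemma sum_prod_bern_of_apply_eq [DecidableEq κ] (p : κ → ℝ) (j : κ) (b : Bool) :
    ∑ x : κ → Bool with x j = b, ∏ l, bern (p l) (x l) = bern (p j) b := by
  have hbox : univ.filter (fun x : κ → Bool => x j = b) =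
      Fintype.piFinset fun l => if l = j then {b} else univ := by
    ext x
    simp only [mem_filter_univ, Fintype.mem_piFinset]
    refine ⟨fun hx l => ?_, fun hx => by simpa using hx j⟩
    split_ifs with hl
    · simp [hl, hx]
    · exact mem_univ _
  rw [hbox, ← prod_univ_sum _ fun l b => bern (p l) b, prod_eq_single j]
  · simp
  · intro l _ hl
    rw [if_neg hl, sum_bern]
  · simp

/-- The likelihood of the Boolean array `g` when its entries are independent Bernoulli variables
with means `M t j`. The likelihood of the hub model given the labels `z` is the case
`M = fun t => A (z t)`. -/
def lik (M : ι → κ → ℝ) (g : ι → κ → Bool) : ℝ :=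
  ∏ t, ∏ j, bern (M t j) (g t j)

lemma lik_nonneg {M : ι → κ → ℝ} (hM : ∀ t j, M t j ∈ Set.Icc (0 : ℝ) 1)
    (g : ι → κ → Bool) : 0 ≤ lik M g :=
  prod_nonneg fun t _ => prod_bern_nonneg (hM t) _

lemma lik_comp [DecidableEq K] (B : K → κ → ℝ) (z : ι → K) (g : ι → κ → Bool) :
    lik (fun t => B (z t)) g = ∏ k, ∏ j, ∏ t with z t = k, bern (B k j) (g t j) := by
  rw [lik, ← prod_fiberwise univ z]
  refine prod_congr rfl fun k _ => ?_
  rw [Finset.prod_comm]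
  refine prod_congr rfl fun j _ => prod_congr rfl fun t ht => ?_
  rw [(mem_filter.1 ht).2]

/-- The squared Frobenius distance between two matrices of means. -/
def sqDist (M N : ι → κ → ℝ) : ℝ :=
  ∑ t, ∑ j, (M t j - N t j) ^ 2

end Bernoulli

section EmpiricalFrequency

variable {ι κ K : Type*} [Fintype ι] [Fintype κ] [Fintype K]

lemma pow_le_div_pow_mul_exp {x s : ℝ} (hx : 0 ≤ x) (hs : 0 < s) (k : ℕ) :
    x ^ k ≤ (k / s) ^ k * Real.exp (x * s - k) := by
  rcases Nat.eq_zero_or_pos k with rfl | hk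
  · simpa using mul_nonneg hx hs.le
  have hx_le : x ≤ (k / s) * Real.exp (x * s / k - 1) :=
    calc x = (k / s) * (x * s / k - 1 + 1) := by field_simp; ring
      _ ≤ (k / s) * Real.exp (x * s / k - 1) := by
        gcongr
        exact Real.add_one_le_exp _
  calc x ^ k ≤ ((k / s) * Real.exp (x * s / k - 1)) ^ k := pow_le_pow_left₀ hx hx_le k
    _ = (k / s) ^ k * Real.exp (x * s - k) := by
      rw [mul_pow, ← Real.exp_nat_mul]
      congr 2
      field_simp

lemma pow_mul_one_sub_pow_le {b : ℝ} (hb : b ∈ Set.Icc (0 : ℝ) 1) (m l : ℕ) :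
    b ^ m * (1 - b) ^ l ≤ ((m : ℝ) / (m + l)) ^ m * (1 - (m : ℝ) / (m + l)) ^ l := by
  rcases Nat.eq_zero_or_pos (m + l) with h | h
  · obtain ⟨rfl, rfl⟩ : m = 0 ∧ l = 0 := by omega
    simp
  have hs : (0 : ℝ) < m + l := by exact_mod_cast h
  have hb' : 0 ≤ 1 - b := sub_nonneg.2 hb.2
  rw [one_sub_div hs.ne', add_sub_cancel_left]
  calc b ^ m * (1 - b) ^ l
      ≤ ((m / (m + l)) ^ m * Real.exp (b * (m + l) - m)) *
          ((l / (m + l)) ^ l * Real.exp ((1 - b) * (m + l) - l)) :=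
        mul_le_mul (pow_le_div_pow_mul_exp hb.1 hs m) (pow_le_div_pow_mul_exp hb' hs l)
          (pow_nonneg hb' _) (by positivity)
    _ = (m / (m + l)) ^ m * (l / (m + l)) ^ l *
          Real.exp (b * (m + l) - m + ((1 - b) * (m + l) - l)) := by
        rw [Real.exp_add]; ring
    _ = (m / (m + l)) ^ m * (l / (m + l)) ^ l := by
        rw [show b * ((m : ℝ) + l) - m + ((1 - b) * (m + l) - l) = 0 by ring, Real.exp_zero,
          mul_one]

/-- The possible empirical frequencies in samples of size at most `N`. -/
noncomputable def freqGrid (N : ℕ) : Finset ℝ :=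
  image₂ (fun a b : ℕ => (a : ℝ) / (a + b)) (range (N + 1)) (range (N + 1))

lemma mem_Icc_of_mem_freqGrid {N : ℕ} {x : ℝ} (hx : x ∈ freqGrid N) : x ∈ Set.Icc (0 : ℝ) 1 := by
  obtain ⟨a, -, b, -, rfl⟩ := mem_image₂.1 hx
  exact ⟨by positivity, div_le_one_of_le₀ (by simp) (by positivity)⟩

lemma card_freqGrid_le (N : ℕ) : #(freqGrid N) ≤ (N + 1) ^ 2 := by
  refine (card_image₂_le _ _ _).trans ?_
  rw [card_range, sq]

lemma exists_mem_freqGrid_prod_bern_le (s : Finset ι) (x : ι → Bool) :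
    ∃ f ∈ freqGrid (Fintype.card ι), ∀ b ∈ Set.Icc (0 : ℝ) 1,
      ∏ t ∈ s, bern b (x t) ≤ ∏ t ∈ s, bern f (x t) := by
  have hcard (u : Finset ι) : #u ∈ range (Fintype.card ι + 1) :=
    mem_range.2 (Nat.lt_succ_of_le (card_le_univ u))
  have hprod (b : ℝ) : ∏ t ∈ s, bern b (x t) =
      b ^ #{t ∈ s | x t = true} * (1 - b) ^ #{t ∈ s | ¬x t = true} := by
    simp only [bern, prod_ite, prod_const]
  refine ⟨_, mem_image₂_of_mem (hcard {t ∈ s | x t = true}) (hcard {t ∈ s | ¬x t = true}),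
    fun b hb => ?_⟩
  rw [hprod, hprod]
  exact pow_mul_one_sub_pow_le hb _ _

variable [DecidableEq K] [DecidableEq κ]

/-- The matrices with entries in `freqGrid (card ι)`, which contain the maximum likelihood
estimates of the parameters from samples indexed by `ι`. -/
noncomputable def freqMatrices (ι K κ : Type*) [Fintype ι] [Fintype K] [Fintype κ]
    [DecidableEq K] [DecidableEq κ] : Finset (K → κ → ℝ) :=
  Fintype.piFinset fun _ => Fintype.piFinset fun _ => freqGrid (Fintype.card ι)

lemma mem_freqMatrices {B : K → κ → ℝ} :
    B ∈ freqMatrices ι K κ ↔ ∀ k j, B k j ∈ freqGrid (Fintype.card ι) := by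
  simp [freqMatrices, Fintype.mem_piFinset]

lemma exists_mem_freqMatrices_lik_le (z : ι → K) (g : ι → κ → Bool) :
    ∃ B ∈ freqMatrices ι K κ, ∀ C : K → κ → ℝ, (∀ k j, C k j ∈ Set.Icc (0 : ℝ) 1) →
      lik (fun t => C (z t)) g ≤ lik (fun t => B (z t)) g := by
  choose B hB hBmax using fun k j =>
    exists_mem_freqGrid_prod_bern_le {t | z t = k} (fun t : ι => g t j)
  refine ⟨B, mem_freqMatrices.2 hB, fun C hC => ?_⟩
  have hcell (k : K) (j : κ) : 0 ≤ ∏ t with z t = k, bern (C k j) (g t j) :=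
    prod_nonneg fun t _ => bern_nonneg (hC k j) _
  rw [lik_comp, lik_comp]
  exact prod_le_prod (fun k _ => prod_nonneg fun j _ => hcell k j) fun k _ =>
    prod_le_prod (fun j _ => hcell k j) fun j _ => hBmax k j (C k j) (hC k j)

/-- The matrices of means `fun t => B (z t)` that a maximum likelihood fit of the parameters and
the labels can produce. Being finite in number, they are amenable to a union bound. -/
noncomputable def fittedMeans (ι K κ : Type*) [Fintype ι] [Fintype K] [Fintype κ]
    [DecidableEq ι] [DecidableEq K] [DecidableEq κ] : Finset (ι → κ → ℝ) :=
  image₂ (fun B z => fun t => B (z t)) (freqMatrices ι K κ) (univ : Finset (ι → K))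

lemma mem_Icc_of_mem_fittedMeans [DecidableEq ι] {M : ι → κ → ℝ} (hM : M ∈ fittedMeans ι K κ)
    (t : ι) (j : κ) : M t j ∈ Set.Icc (0 : ℝ) 1 := by
  obtain ⟨B, hB, z, -, rfl⟩ := mem_image₂.1 hM
  exact mem_Icc_of_mem_freqGrid (mem_freqMatrices.1 hB (z t) j)

lemma card_fittedMeans_le [DecidableEq ι] : #(fittedMeans ι K κ) ≤
    Fintype.card K ^ Fintype.card ι *
      (Fintype.card ι + 1) ^ (2 * Fintype.card K * Fintype.card κ) := by
  have hB : #(freqMatrices ι K κ) ≤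
      (Fintype.card ι + 1) ^ (2 * Fintype.card K * Fintype.card κ) :=
    calc #(freqMatrices ι K κ)
        = (#(freqGrid (Fintype.card ι)) ^ Fintype.card κ) ^ Fintype.card K := by
          simp [freqMatrices, Fintype.card_piFinset]
      _ ≤ (((Fintype.card ι + 1) ^ 2) ^ Fintype.card κ) ^ Fintype.card K := by
          gcongr
          exact card_freqGrid_le _
      _ = (Fintype.card ι + 1) ^ (2 * Fintype.card K * Fintype.card κ) := by
          rw [← pow_mul, ← pow_mul, mul_assoc, mul_comm (Fintype.card κ), ← mul_assoc]
  calc #(fittedMeans ι K κ) ≤ #(freqMatrices ι K κ) * #(univ : Finset (ι → K)) :=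
        card_image₂_le _ _ _
    _ ≤ (Fintype.card ι + 1) ^ (2 * Fintype.card K * Fintype.card κ) *
          Fintype.card K ^ Fintype.card ι := by
        gcongr
        simp
    _ = _ := mul_comm _ _

end EmpiricalFrequency

section ProfileLikelihood

variable {nL n T : ℕ} {h : nL ≤ n} {g : Fin T → Fin n → Bool} {z : Fin T → Fin (nL + 1)}
  {A : Fin (nL + 1) → Fin n → ℝ}

lemma log_ofReal_prod {ι : Type*} (s : Finset ι) {f : ι → ℝ} (hf : ∀ i ∈ s, 0 ≤ f i) :
    ENNReal.log (ENNReal.ofReal (∏ i ∈ s, f i)) =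
      ∑ i ∈ s, ENNReal.log (ENNReal.ofReal (f i)) := by
  induction s using Finset.cons_induction with
  | empty => simp
  | cons a s ha ih =>
    rw [forall_mem_cons] at hf
    rw [prod_cons, sum_cons, ENNReal.ofReal_mul hf.1, ENNReal.log_mul_add, ih hf.2]

lemma logLik_eq_log_lik (hA : ∀ i j, A i j ∈ Set.Icc (0 : ℝ) 1) (g : Fin T → Fin n → Bool)
    (z : Fin T → Fin (nL + 1)) :
    logLik g A z = ENNReal.log (ENNReal.ofReal (lik (fun t => A (z t)) g)) := by
  rw [lik, log_ofReal_prod _ fun t _ => prod_bern_nonneg (fun j => hA (z t) j) _]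
  exact sum_congr rfl fun t _ => (log_ofReal_prod _ fun j _ => bern_nonneg (hA _ _) _).symm

lemma logLik_le_profileLogLik (hA : A ∈ paramSpace h) (g : Fin T → Fin n → Bool)
    (z : Fin T → Fin (nL + 1)) : logLik g A z ≤ profileLogLik h g z :=
  le_iSup₂_of_le A hA le_rfl

lemma IsProfileMLE.exists_lik_le (hz : IsProfileMLE h g z) (hA : A ∈ paramSpace h)
    (ζ : Fin T → Fin (nL + 1)) :
    ∃ B : Fin (nL + 1) → Fin n → ℝ,
      (fun t => B (z t)) ∈ fittedMeans (Fin T) (Fin (nL + 1)) (Fin n) ∧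
        lik (fun t => A (ζ t)) g ≤ lik (fun t => B (z t)) g := by
  obtain ⟨B, hB, hBmax⟩ := exists_mem_freqMatrices_lik_le z g
  have hB01 (i : Fin (nL + 1)) (j : Fin n) : B i j ∈ Set.Icc (0 : ℝ) 1 :=
    mem_Icc_of_mem_freqGrid (mem_freqMatrices.1 hB i j)
  have hprofile : profileLogLik h g z ≤ logLik g B z := by
    refine iSup₂_le fun C hC => ?_
    rw [logLik_eq_log_lik hC.1, logLik_eq_log_lik hB01]
    exact ENNReal.log_monotone (ENNReal.ofReal_le_ofReal (hBmax C hC.1))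
  have hle : logLik g A ζ ≤ logLik g B z :=
    (logLik_le_profileLogLik hA g ζ).trans ((hz ζ).trans hprofile)
  rw [logLik_eq_log_lik hA.1, logLik_eq_log_lik hB01, ENNReal.log_le_log_iff] at hle
  exact ⟨B, mem_image₂_of_mem hB (mem_univ z),
    (ENNReal.ofReal_le_ofReal_iff (lik_nonneg (fun _ _ => hB01 _ _) _)).1 hle⟩

lemma profileLogLik_zero_ne_bot (h : nL ≤ n) (g : Fin T → Fin n → Bool) :
    profileLogLik h g (fun _ => 0) ≠ ⊥ := by
  let B : Fin (nL + 1) → Fin n → ℝ := fun i _ => if i = 0 then 1 / 2 else 1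
  have hB : B ∈ paramSpace h := by
    refine ⟨fun i j => ?_, fun i => by simp [B]⟩
    by_cases hi : i = 0 <;> norm_num [B, hi]
  have hpos : 0 < lik (fun _ : Fin T => B 0) g := by
    refine prod_pos fun t _ => prod_pos fun j _ => ?_
    cases g t j <;> norm_num [bern, B]
  refine ne_bot_of_le_ne_bot ?_ (logLik_le_profileLogLik hB g _)
  rw [logLik_eq_log_lik hB.1, Ne, ENNReal.log_eq_bot_iff, ENNReal.ofReal_eq_zero]
  exact not_le.2 hpos

lemma profileLogLik_eq_bot {t : Fin T} {k : Fin nL} (hk : z t = k.succ)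
    (hg : g t (Fin.castLE h k) = false) : profileLogLik h g z = ⊥ := by
  refine le_bot_iff.1 (iSup₂_le fun A hA => ?_)
  have hzero : lik (fun t => A (z t)) g = 0 :=
    prod_eq_zero (mem_univ t) (prod_eq_zero (mem_univ (Fin.castLE h k)) (by
      simp [hk, hA.2 k, bern, hg]))
  rw [logLik_eq_log_lik hA.1, hzero, ENNReal.ofReal_zero, ENNReal.log_zero]

lemma IsProfileMLE.apply_hub_eq_true (hz : IsProfileMLE h g z) {t : Fin T} {k : Fin nL}
    (hk : z t = k.succ) : g t (Fin.castLE h k) = true := by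
  by_contra hg
  refine profileLogLik_zero_ne_bot h g (le_bot_iff.1 ((hz fun _ => 0).trans ?_))
  rw [profileLogLik_eq_bot hk (Bool.eq_false_iff.2 hg)]

end ProfileLikelihood

section Confusion

variable {nL n T : ℕ} {A B : Fin (nL + 1) → Fin n → ℝ} {ζ z : Fin T → Fin (nL + 1)}

lemma sum_crossCount (ζ z : Fin T → Fin (nL + 1)) (i : Fin (nL + 1)) :
    ∑ k, crossCount ζ z i k = trueCount ζ i := by
  simp only [crossCount, trueCount, ← filter_filter]
  exact (card_eq_sum_card_fiberwise fun _ _ => mem_univ _).symm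

lemma crossCount_add_crossCount_le (ζ z : Fin T → Fin (nL + 1)) {i k l : Fin (nL + 1)}
    (hkl : k ≠ l) : crossCount ζ z i k + crossCount ζ z i l ≤ trueCount ζ i := by
  rw [← sum_crossCount ζ z i, ← sum_pair hkl]
  exact sum_le_sum_of_subset (subset_univ _)

lemma crossCount_mul_add_le_sqDist {i i' : Fin (nL + 1)} (hne : i ≠ i') (k : Fin (nL + 1)) :
    crossCount ζ z i k * ∑ j, (B k j - A i j) ^ 2 +
        crossCount ζ z i' k * ∑ j, (B k j - A i' j) ^ 2 ≤
      sqDist (fun t => B (z t)) (fun t => A (ζ t)) := by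
  have hcell (a : Fin (nL + 1)) : crossCount ζ z a k * ∑ j, (B k j - A a j) ^ 2 =
      ∑ t with ζ t = a ∧ z t = k, ∑ j, (B (z t) j - A (ζ t) j) ^ 2 := by
    rw [crossCount, ← nsmul_eq_mul, ← sum_const]
    refine sum_congr rfl fun t ht => ?_
    obtain ⟨-, rfl, rfl⟩ := mem_filter.1 ht
    rfl
  have hdisj : Disjoint (univ.filter fun t => ζ t = i ∧ z t = k)
      (univ.filter fun t => ζ t = i' ∧ z t = k) :=
    disjoint_filter.2 fun t _ ht ht' => hne (ht.1.symm.trans ht'.1)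
  rw [hcell, hcell, ← sum_union hdisj]
  exact sum_le_univ_sum_of_nonneg fun t => sum_nonneg fun j _ => sq_nonneg _

lemma min_mul_sq_le {x y : ℝ} (hx : 0 ≤ x) (hy : 0 ≤ y) (b p q : ℝ) :
    min x y * (p - q) ^ 2 ≤ 2 * (x * (b - p) ^ 2 + y * (b - q) ^ 2) := by
  have hsq : (p - q) ^ 2 ≤ 2 * ((b - p) ^ 2 + (b - q) ^ 2) := by
    nlinarith [sq_nonneg ((b - p) + (b - q))]
  calc min x y * (p - q) ^ 2 ≤ min x y * (2 * ((b - p) ^ 2 + (b - q) ^ 2)) := by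
        gcongr
    _ = 2 * (min x y * (b - p) ^ 2 + min x y * (b - q) ^ 2) := by ring
    _ ≤ 2 * (x * (b - p) ^ 2 + y * (b - q) ^ 2) := by
        gcongr
        · exact min_le_left x y
        · exact min_le_right x y

lemma min_crossCount_mul_le {i i' : Fin (nL + 1)} (hne : i ≠ i') (k : Fin (nL + 1)) :
    min (crossCount ζ z i k : ℝ) (crossCount ζ z i' k) * ∑ j, (A i j - A i' j) ^ 2 ≤
      2 * sqDist (fun t => B (z t)) (fun t => A (ζ t)) := by
  calc min (crossCount ζ z i k : ℝ) (crossCount ζ z i' k) * ∑ j, (A i j - A i' j) ^ 2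
      ≤ ∑ j, 2 * (crossCount ζ z i k * (B k j - A i j) ^ 2 +
          crossCount ζ z i' k * (B k j - A i' j) ^ 2) := by
        rw [mul_sum]
        exact sum_le_sum fun j _ => min_mul_sq_le (Nat.cast_nonneg _) (Nat.cast_nonneg _) _ _ _
    _ = 2 * (crossCount ζ z i k * ∑ j, (B k j - A i j) ^ 2 +
          crossCount ζ z i' k * ∑ j, (B k j - A i' j) ^ 2) := by
        rw [← mul_sum, sum_add_distrib, mul_sum, mul_sum]
    _ ≤ 2 * sqDist (fun t => B (z t)) (fun t => A (ζ t)) := by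
        gcongr
        exact crossCount_mul_add_le_sqDist hne k

-- A relation with these properties is the graph of a permutation that fixes `o`, hence of `id`.
lemma eq_of_leftUnique_of_exists_ne {ι : Type*} [Finite ι] {r : ι → ι → Prop} (o : ι)
    (huniq : ∀ i i' k, r i k → r i' k → i = i') (htotal : ∀ i, ∃ k, r i k)
    (hother : ∀ i k, k ≠ i → k ≠ o → ∃ l ≠ k, r i l) {i k : ι} (hik : r i k) : k = i := by
  choose f hf using htotal
  have hinj : f.Injective := fun i i' h => huniq i i' (f i) (hf i) (h ▸ hf i')
  have eq_f {i k : ι} (hik : r i k) : k = f i := by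
    obtain ⟨i', rfl⟩ := Finite.surjective_of_injective hinj k
    rw [huniq i i' _ hik (hf i')]
  have hf_or (i : ι) : f i = i ∨ f i = o := by
    by_contra! hne
    obtain ⟨l, hl, hil⟩ := hother i (f i) hne.1 hne.2
    exact hl (eq_f hil)
  have hfo : f o = o := (hf_or o).elim id id
  rw [eq_f hik]
  exact (hf_or i).elim id fun hio => hio.trans (hinj (hio.trans hfo.symm)).symm

/-- The number of groups with true label `i` that do not contain the node `j`. -/
def absentCount (ζ : Fin T → Fin (nL + 1)) (g : Fin T → Fin n → Bool) (i : Fin (nL + 1))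
    (j : Fin n) : ℕ :=
  #{t | ζ t = i ∧ g t j = false}

variable {h : nL ≤ n} {g : Fin T → Fin n → Bool}

lemma absentCount_le_trueCount (ζ : Fin T → Fin (nL + 1)) (g : Fin T → Fin n → Bool)
    (i : Fin (nL + 1)) (j : Fin n) : absentCount ζ g i j ≤ trueCount ζ i :=
  card_le_card (monotone_filter_right _ fun _ _ ht => ht.1)

lemma IsProfileMLE.absentCount_le_sum (hz : IsProfileMLE h g z) (ζ : Fin T → Fin (nL + 1))
    (i : Fin (nL + 1)) (k : Fin nL) :
    absentCount ζ g i (Fin.castLE h k) ≤ ∑ l ∈ univ.erase k.succ, crossCount ζ z i l := by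
  have hmaps : Set.MapsTo z (univ.filter fun t => ζ t = i ∧ g t (Fin.castLE h k) = false)
      (univ.erase k.succ : Finset (Fin (nL + 1))) := by
    intro t ht
    simp only [coe_filter, Set.mem_ofPred_eq, mem_univ, true_and] at ht
    simp only [coe_erase, coe_univ, Set.mem_sdiff, Set.mem_univ, Set.mem_singleton_iff, true_and]
    intro hk
    simp [hz.apply_hub_eq_true hk] at ht
  rw [absentCount, card_eq_sum_card_fiberwise hmaps]
  refine sum_le_sum fun l _ => card_le_card fun t => ?_
  simp only [mem_filter, mem_univ, true_and]
  tauto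

lemma IsProfileMLE.exists_lt_crossCount (hz : IsProfileMLE h g z) {τ : ℝ} {i : Fin (nL + 1)}
    {k : Fin nL} (habs : nL * τ < absentCount ζ g i (Fin.castLE h k)) :
    ∃ l ≠ k.succ, τ < crossCount ζ z i l := by
  have hsum : ∑ _l ∈ univ.erase k.succ, τ < ∑ l ∈ univ.erase k.succ, (crossCount ζ z i l : ℝ) :=
    calc ∑ _l ∈ univ.erase k.succ, τ = nL * τ := by simp [card_erase_of_mem]
      _ < absentCount ζ g i (Fin.castLE h k) := habs
      _ ≤ ∑ l ∈ univ.erase k.succ, (crossCount ζ z i l : ℝ) := by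
        exact_mod_cast hz.absentCount_le_sum ζ i k
  obtain ⟨l, hl, hτ⟩ := exists_lt_of_sum_lt hsum
  exact ⟨l, ne_of_mem_erase hl, hτ⟩

lemma exists_succ_ne (hL : 2 ≤ nL) (i : Fin (nL + 1)) : ∃ k : Fin nL, i ≠ k.succ := by
  have : Nontrivial (Fin nL) := Fin.nontrivial_iff_two_le.2 hL
  obtain ⟨k, k', hne⟩ := exists_pair_ne (Fin nL)
  by_cases hk : i = k.succ
  · exact ⟨k', fun hk' => hne (Fin.succ_injective _ (hk.symm.trans hk'))⟩
  · exact ⟨k, hk⟩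

lemma IsProfileMLE.crossCount_le (hz : IsProfileMLE h g z) (hA : A ∈ paramSpace h) (hL : 2 ≤ nL)
    {τ Δ : ℝ} (hΔ : 0 < Δ) (hsep : ∀ i i', i ≠ i' → Δ ≤ ∑ j, (A i j - A i' j) ^ 2)
    (habs : ∀ i (k : Fin nL), i ≠ k.succ → nL * τ < absentCount ζ g i (Fin.castLE h k))
    (hlik : ∀ M ∈ fittedMeans (Fin T) (Fin (nL + 1)) (Fin n),
      τ * Δ / 2 < sqDist M (fun t => A (ζ t)) → lik M g < lik (fun t => A (ζ t)) g)
    {i k : Fin (nL + 1)} (hik : k ≠ i) : (crossCount ζ z i k : ℝ) ≤ τ := by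
  obtain ⟨B, hBmem, hB⟩ := hz.exists_lik_le hA ζ
  have hdist : sqDist (fun t => B (z t)) (fun t => A (ζ t)) ≤ τ * Δ / 2 :=
    not_lt.1 fun hlt => (hlik _ hBmem hlt).not_ge hB
  have huniq (i i' k : Fin (nL + 1)) (hi : τ < crossCount ζ z i k)
      (hi' : τ < crossCount ζ z i' k) : i = i' := by
    by_contra hne
    have hmin : min (crossCount ζ z i k : ℝ) (crossCount ζ z i' k) * Δ ≤ τ * Δ :=
      calc min (crossCount ζ z i k : ℝ) (crossCount ζ z i' k) * Δ
          ≤ min (crossCount ζ z i k : ℝ) (crossCount ζ z i' k) * ∑ j, (A i j - A i' j) ^ 2 := by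
            gcongr
            exact hsep i i' hne
        _ ≤ 2 * sqDist (fun t => B (z t)) (fun t => A (ζ t)) := min_crossCount_mul_le hne k
        _ ≤ τ * Δ := by linarith
    exact (lt_min hi hi').not_ge (le_of_mul_le_mul_right hmin hΔ)
  by_contra! hlt
  refine hik (eq_of_leftUnique_of_exists_ne (r := fun i k => τ < crossCount ζ z i k) 0 huniq
    (fun i => ?_) (fun i k hki hk0 => ?_) hlt)
  · obtain ⟨k, hk⟩ := exists_succ_ne hL i
    obtain ⟨l, -, hl⟩ := hz.exists_lt_crossCount (habs i k hk)
    exact ⟨l, hl⟩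
  · obtain ⟨k, rfl⟩ := Fin.exists_succ_eq.2 hk0
    exact hz.exists_lt_crossCount (habs i k hki.symm)

lemma one_sub_le_crossCount_div_trueCount {τ ε : ℝ} {i : Fin (nL + 1)}
    (hcross : ∀ k, k ≠ i → (crossCount ζ z i k : ℝ) ≤ τ) (hpos : 0 < trueCount ζ i)
    (hτ : nL * τ ≤ ε * trueCount ζ i) :
    1 - ε ≤ (crossCount ζ z i i : ℝ) / trueCount ζ i := by
  have hoff : ∑ k ∈ univ.erase i, (crossCount ζ z i k : ℝ) ≤ nL * τ := by
    refine (sum_le_card_nsmul _ _ _ fun k hk => hcross k (ne_of_mem_erase hk)).trans_eq ?_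
    simp [card_erase_of_mem]
  have hsum : (crossCount ζ z i i : ℝ) + ∑ k ∈ univ.erase i, (crossCount ζ z i k : ℝ) =
      trueCount ζ i := by
    rw [add_sum_erase _ (fun k => (crossCount ζ z i k : ℝ)) (mem_univ i)]
    exact_mod_cast sum_crossCount ζ z i
  rw [le_div_iff₀ (by exact_mod_cast hpos)]
  linarith

end Confusion

section FiniteLaw

variable {Ω α ι : Type*} [MeasurableSpace Ω] {μ : Measure Ω} [IsFiniteMeasure μ] [Fintype α]

lemma measureReal_le_sum_of_forall_le {X : Ω → α} {w H : α → ℝ}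
    (hX : ∀ x, μ.real {ω | X ω = x} = w x) {P : α → Prop} (hH : ∀ x, 0 ≤ H x)
    (hP : ∀ x, P x → w x ≤ H x) : μ.real {ω | P (X ω)} ≤ ∑ x, H x := by
  classical
  calc μ.real {ω | P (X ω)} ≤ μ.real (⋃ x ∈ univ.filter P, {ω | X ω = x}) :=
        measureReal_mono (fun ω hω => by simpa using hω) (measure_ne_top _ _)
    _ ≤ ∑ x with P x, μ.real {ω | X ω = x} := measureReal_biUnion_finset_le _ _
    _ ≤ ∑ x with P x, H x :=
        sum_le_sum fun x hx => (hX x).trans_le (hP x (mem_filter.1 hx).2)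
    _ ≤ ∑ x, H x := sum_le_univ_sum_of_nonneg hH

lemma sum_mul_ite_exp_neg_one_le {w : α → ℝ} (hw : ∀ b, 0 ≤ w b) (hsum : ∑ b, w b = 1)
    (D : α → Prop) [DecidablePred D] :
    ∑ b, w b * (if D b then Real.exp (-1) else 1) ≤ Real.exp (-(3 / 5 * ∑ b with D b, w b)) := by
  have hp : 0 ≤ ∑ b with D b, w b := sum_nonneg fun b _ => hw b
  have hsplit : ∑ b, w b * (if D b then Real.exp (-1) else 1) =
      1 - (1 - Real.exp (-1)) * ∑ b with D b, w b := by
    rw [eq_sub_iff_add_eq, sum_filter, mul_sum, ← sum_add_distrib]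
    refine (sum_congr rfl fun b _ => ?_).trans hsum
    split_ifs <;> ring
  have hexp : 3 / 5 ≤ 1 - Real.exp (-1) := by linarith [Real.exp_neg_one_lt_d9]
  calc ∑ b, w b * (if D b then Real.exp (-1) else 1)
      = 1 - (1 - Real.exp (-1)) * ∑ b with D b, w b := hsplit
    _ ≤ 1 - 3 / 5 * ∑ b with D b, w b := by gcongr
    _ ≤ Real.exp (-(3 / 5 * ∑ b with D b, w b)) := Real.one_sub_le_exp_neg _

lemma measureReal_card_le_half_le [Fintype ι] {X : Ω → ι → α} {w : α → ℝ}
    (hw : ∀ b, 0 ≤ w b) (hsum : ∑ b, w b = 1)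
    (hX : ∀ x, μ.real {ω | X ω = x} = ∏ t, w (x t)) (D : α → Prop) [DecidablePred D] {a : ℝ}
    (ha : a ≤ Fintype.card ι * ∑ b with D b, w b) :
    μ.real {ω | (#{t | D (X ω t)} : ℝ) ≤ a / 2} ≤ Real.exp (-(a / 10)) := by
  classical
  let φ : α → ℝ := fun b => if D b then Real.exp (-1) else 1
  have hφ (b : α) : 0 ≤ φ b := by
    simp only [φ]
    split_ifs <;> positivity
  have hprod (x : ι → α) : ∏ t, φ (x t) = Real.exp (-#{t | D (x t)}) := by
    rw [prod_ite, prod_const, prod_const_one, mul_one, ← Real.exp_nat_mul, mul_neg_one]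
  have htilt (x : ι → α) (hx : (#{t | D (x t)} : ℝ) ≤ a / 2) :
      ∏ t, w (x t) ≤ Real.exp (a / 2) * ∏ t, w (x t) * φ (x t) := by
    rw [prod_mul_distrib, hprod, mul_left_comm, ← Real.exp_add]
    exact le_mul_of_one_le_right (prod_nonneg fun t _ => hw _) (Real.one_le_exp (by linarith))
  calc μ.real {ω | (#{t | D (X ω t)} : ℝ) ≤ a / 2}
      ≤ ∑ x : ι → α, Real.exp (a / 2) * ∏ t, w (x t) * φ (x t) :=
        measureReal_le_sum_of_forall_le (P := fun x => (#{t | D (x t)} : ℝ) ≤ a / 2) hX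
          (fun x => mul_nonneg (Real.exp_nonneg _)
            (prod_nonneg fun t _ => mul_nonneg (hw _) (hφ _))) htilt
    _ = Real.exp (a / 2) * (∑ b, w b * φ b) ^ Fintype.card ι := by
        rw [← mul_sum, ← Fintype.prod_sum fun (_ : ι) b => w b * φ b, prod_const, card_univ]
    _ ≤ Real.exp (a / 2) * Real.exp (-(3 / 5 * ∑ b with D b, w b)) ^ Fintype.card ι := by
        gcongr
        · exact sum_nonneg fun b _ => mul_nonneg (hw b) (hφ b)
        · exact sum_mul_ite_exp_neg_one_le hw hsum D
    _ ≤ Real.exp (-(a / 10)) := by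
        rw [← Real.exp_nat_mul, ← Real.exp_add, Real.exp_le_exp]
        linarith

end FiniteLaw

section Hellinger

variable {ι κ : Type*} [Fintype ι] [Fintype κ]

lemma sqrt_mul_le_of_mem_Icc {x y : ℝ} (hx : x ∈ Set.Icc (0 : ℝ) 1)
    (hy : y ∈ Set.Icc (0 : ℝ) 1) : √(x * y) ≤ (x + y) / 2 - (x - y) ^ 2 / 8 := by
  have hsum : (√x + √y) ^ 2 ≤ 4 := by
    nlinarith [Real.sqrt_nonneg x, Real.sqrt_nonneg y, Real.sqrt_le_one.2 hx.2,
      Real.sqrt_le_one.2 hy.2]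
  have hdiff : (x - y) ^ 2 = (√x - √y) ^ 2 * (√x + √y) ^ 2 := by
    rw [← mul_pow, mul_comm, ← sq_sub_sq, Real.sq_sqrt hx.1, Real.sq_sqrt hy.1]
  have hle : (x - y) ^ 2 ≤ (√x - √y) ^ 2 * 4 := by
    rw [hdiff]
    gcongr
  rw [Real.sqrt_mul hx.1]
  linarith [sub_sq (√x) (√y), Real.sq_sqrt hx.1, Real.sq_sqrt hy.1]

lemma sum_sqrt_bern_mul_bern_le {p q : ℝ} (hp : p ∈ Set.Icc (0 : ℝ) 1)
    (hq : q ∈ Set.Icc (0 : ℝ) 1) :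
    ∑ b, √(bern p b * bern q b) ≤ Real.exp (-((p - q) ^ 2 / 4)) := by
  have hcompl {x : ℝ} (hx : x ∈ Set.Icc (0 : ℝ) 1) : 1 - x ∈ Set.Icc (0 : ℝ) 1 :=
    ⟨sub_nonneg.2 hx.2, sub_le_self 1 hx.1⟩
  calc ∑ b, √(bern p b * bern q b) = √(p * q) + √((1 - p) * (1 - q)) := by simp [bern]
    _ ≤ 1 - (p - q) ^ 2 / 4 := by
        linarith [sqrt_mul_le_of_mem_Icc hp hq, sqrt_mul_le_of_mem_Icc (hcompl hp) (hcompl hq)]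
    _ ≤ Real.exp (-((p - q) ^ 2 / 4)) := Real.one_sub_le_exp_neg _

lemma sum_sqrt_lik_mul_lik_le [DecidableEq ι] [DecidableEq κ] {M N : ι → κ → ℝ}
    (hM : ∀ t j, M t j ∈ Set.Icc (0 : ℝ) 1) (hN : ∀ t j, N t j ∈ Set.Icc (0 : ℝ) 1) :
    ∑ g, √(lik M g * lik N g) ≤ Real.exp (-(sqDist M N / 4)) := by
  have hsqrt (g : ι → κ → Bool) : √(lik M g * lik N g) =
      ∏ t, ∏ j, √(bern (M t j) (g t j) * bern (N t j) (g t j)) := by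
    simp only [lik, ← prod_mul_distrib]
    rw [Real.sqrt_prod _ fun t _ => prod_nonneg fun j _ =>
      mul_nonneg (bern_nonneg (hM t j) _) (bern_nonneg (hN t j) _)]
    exact prod_congr rfl fun t _ => Real.sqrt_prod _ fun j _ =>
      mul_nonneg (bern_nonneg (hM t j) _) (bern_nonneg (hN t j) _)
  calc ∑ g, √(lik M g * lik N g)
      = ∏ t, ∏ j, ∑ b, √(bern (M t j) b * bern (N t j) b) := by
        simp only [hsqrt, Fintype.prod_sum]
    _ ≤ ∏ t, ∏ j, Real.exp (-((M t j - N t j) ^ 2 / 4)) :=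
        prod_le_prod (fun t _ => prod_nonneg fun j _ => sum_nonneg fun b _ => Real.sqrt_nonneg _)
          fun t _ => prod_le_prod (fun j _ => sum_nonneg fun b _ => Real.sqrt_nonneg _)
            fun j _ => sum_sqrt_bern_mul_bern_le (hM t j) (hN t j)
    _ = Real.exp (-(sqDist M N / 4)) := by
        simp only [← Real.exp_sum, sum_neg_distrib, ← sum_div, sqDist]

lemma sum_sum_sqrt_lik_mul_lik_le [DecidableEq ι] [DecidableEq κ] {Θ : Finset (ι → κ → ℝ)}
    (hΘ : ∀ M ∈ Θ, ∀ t j, M t j ∈ Set.Icc (0 : ℝ) 1) {N : ι → κ → ℝ}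
    (hN : ∀ t j, N t j ∈ Set.Icc (0 : ℝ) 1) (R : ℝ) :
    ∑ g, ∑ M ∈ Θ with R < sqDist M N, √(lik M g * lik N g) ≤ #Θ * Real.exp (-(R / 4)) :=
  calc ∑ g, ∑ M ∈ Θ with R < sqDist M N, √(lik M g * lik N g)
      = ∑ M ∈ Θ with R < sqDist M N, ∑ g, √(lik M g * lik N g) := sum_comm
    _ ≤ ∑ M ∈ Θ with R < sqDist M N, Real.exp (-(R / 4)) := by
        refine sum_le_sum fun M hM => ?_
        obtain ⟨hMΘ, hR⟩ := mem_filter.1 hM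
        refine (sum_sqrt_lik_mul_lik_le (hΘ M hMΘ) hN).trans ?_
        gcongr
    _ ≤ #Θ * Real.exp (-(R / 4)) := by
        rw [sum_const, nsmul_eq_mul]
        gcongr
        exact filter_subset _ _

end Hellinger

section HubModelLaw

variable {K κ : Type*} [Fintype κ]

/-- The probability that a group has the label `x.1` and the set of members `x.2`. -/
def groupWeight (ρ : K → ℝ) (A : K → κ → ℝ) (x : K × (κ → Bool)) : ℝ :=
  ρ x.1 * ∏ j, bern (A x.1 j) (x.2 j)

lemma groupWeight_nonneg {ρ : K → ℝ} {A : K → κ → ℝ} (hρ : ∀ i, 0 ≤ ρ i)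
    (hA : ∀ i j, A i j ∈ Set.Icc (0 : ℝ) 1) (x : K × (κ → Bool)) : 0 ≤ groupWeight ρ A x :=
  mul_nonneg (hρ _) (prod_bern_nonneg (hA _) _)

lemma sum_groupWeight [Fintype K] [DecidableEq κ] (ρ : K → ℝ) (A : K → κ → ℝ) :
    ∑ x, groupWeight ρ A x = ∑ i, ρ i := by
  simp only [groupWeight, Fintype.sum_prod_type, ← mul_sum, sum_prod_bern, mul_one]

lemma sum_groupWeight_of_absent [Fintype K] [DecidableEq K] [DecidableEq κ] (ρ : K → ℝ)
    (A : K → κ → ℝ) (i : K) (j : κ) :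
    ∑ x with x.1 = i ∧ x.2 j = false, groupWeight ρ A x = ρ i * (1 - A i j) := by
  have hprod : univ.filter (fun x : K × (κ → Bool) => x.1 = i ∧ x.2 j = false) =
      {i} ×ˢ univ.filter fun y : κ → Bool => y j = false := by
    ext x
    simp only [mem_filter_univ, mem_product, mem_singleton]
  rw [hprod, sum_product, sum_singleton]
  simp only [groupWeight]
  rw [← mul_sum, sum_prod_bern_of_apply_eq]
  simp [bern]

variable {Ω : Type*} [MeasurableSpace Ω] {μ : Measure Ω} [IsFiniteMeasure μ] {nL n T : ℕ}
  {ρ : Fin (nL + 1) → ℝ} {A : Fin (nL + 1) → Fin n → ℝ} {zs : Ω → Fin T → Fin (nL + 1)}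
  {G : Ω → Fin T → Fin n → Bool}

lemma IsHubNullModel.measureReal_absentCount_le (hM : IsHubNullModel μ ρ A zs G)
    (hρ : ∀ i, 0 ≤ ρ i) (hρsum : ∑ i, ρ i = 1) (hA : ∀ i j, A i j ∈ Set.Icc (0 : ℝ) 1)
    {a : ℝ} {i : Fin (nL + 1)} {j : Fin n} (ha : a ≤ T * (ρ i * (1 - A i j))) :
    μ.real {ω | (absentCount (zs ω) (G ω) i j : ℝ) ≤ a / 2} ≤ Real.exp (-(a / 10)) := by
  have hlaw (x : Fin T → Fin (nL + 1) × (Fin n → Bool)) :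
      μ.real {ω | (fun t => (zs ω t, G ω t)) = x} = ∏ t, groupWeight ρ A (x t) := by
    simp only [groupWeight, ← hM.law]
    congr 1
    ext ω
    simp [funext_iff, Prod.ext_iff, forall_and]
  refine measureReal_card_le_half_le (groupWeight_nonneg hρ hA)
    ((sum_groupWeight ρ A).trans hρsum) hlaw (fun x => x.1 = i ∧ x.2 j = false) ?_
  rwa [sum_groupWeight_of_absent, Fintype.card_fin]

lemma IsHubNullModel.measureReal_exists_lik_le (hM : IsHubNullModel μ ρ A zs G)
    (hρ : ∀ i, 0 ≤ ρ i) (hρsum : ∑ i, ρ i = 1) (hA : ∀ i j, A i j ∈ Set.Icc (0 : ℝ) 1)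
    {Θ : Finset (Fin T → Fin n → ℝ)} (hΘ : ∀ M ∈ Θ, ∀ t j, M t j ∈ Set.Icc (0 : ℝ) 1) (R : ℝ) :
    μ.real {ω | ∃ M ∈ Θ, R < sqDist M (fun t => A (zs ω t)) ∧
      lik (fun t => A (zs ω t)) (G ω) ≤ lik M (G ω)} ≤ #Θ * Real.exp (-(R / 4)) := by
  let H : (Fin T → Fin (nL + 1)) × (Fin T → Fin n → Bool) → ℝ := fun x =>
    (∏ t, ρ (x.1 t)) * ∑ M ∈ Θ with R < sqDist M fun t => A (x.1 t),
      √(lik M x.2 * lik (fun t => A (x.1 t)) x.2)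
  have hlaw (x : (Fin T → Fin (nL + 1)) × (Fin T → Fin n → Bool)) :
      μ.real {ω | (zs ω, G ω) = x} = (∏ t, ρ (x.1 t)) * lik (fun t => A (x.1 t)) x.2 := by
    rw [lik, ← prod_mul_distrib, ← hM.law]
    simp only [Prod.ext_iff]
  have hH (x : (Fin T → Fin (nL + 1)) × (Fin T → Fin n → Bool)) : 0 ≤ H x :=
    mul_nonneg (prod_nonneg fun t _ => hρ _) (sum_nonneg fun M _ => Real.sqrt_nonneg _)
  calc _ ≤ ∑ x, H x := by
        refine measureReal_le_sum_of_forall_le (X := fun ω => (zs ω, G ω))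
          (P := fun x => ∃ M ∈ Θ, R < sqDist M (fun t => A (x.1 t)) ∧
            lik (fun t => A (x.1 t)) x.2 ≤ lik M x.2) hlaw hH ?_
        rintro ⟨z, g⟩ ⟨M, hMΘ, hR, hle⟩
        have hlik : 0 ≤ lik (fun t => A (z t)) g := lik_nonneg (fun t => hA (z t)) g
        refine mul_le_mul_of_nonneg_left ?_ (prod_nonneg fun t _ => hρ _)
        calc lik (fun t => A (z t)) g ≤ √(lik M g * lik (fun t => A (z t)) g) :=
              Real.le_sqrt_of_sq_le (by rw [sq]; gcongr)
          _ ≤ _ := single_le_sum (f := fun M => √(lik M g * lik (fun t => A (z t)) g))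
              (fun M _ => Real.sqrt_nonneg _) (mem_filter.2 ⟨hMΘ, hR⟩)
    _ ≤ ∑ z : Fin T → Fin (nL + 1), (∏ t, ρ (z t)) * (#Θ * Real.exp (-(R / 4))) := by
        simp only [Fintype.sum_prod_type, H, ← mul_sum]
        gcongr with z
        · exact prod_nonneg fun t _ => hρ _
        · exact sum_sum_sqrt_lik_mul_lik_le hΘ (fun t => hA (z t)) R
    _ = #Θ * Real.exp (-(R / 4)) := by
        rw [← sum_mul, ← Fintype.prod_sum fun (_ : Fin T) i => ρ i, hρsum, prod_const_one, one_mul]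

end HubModelLaw

section FiniteSample

variable {nL n T : ℕ} {h : nL ≤ n} {A : Fin (nL + 1) → Fin n → ℝ}

/-- Consistency of the labels `z` with the true labels `ζ`: every class of `ζ`, the null class
included, is nonempty and receives the right label in a proportion at least `1 - ε`. -/
def AgreesUpTo (ε : ℝ) (ζ z : Fin T → Fin (nL + 1)) : Prop :=
  ∀ i, 0 < trueCount ζ i ∧ 1 - ε ≤ (crossCount ζ z i i : ℝ) / trueCount ζ i

lemma AgreesUpTo.mono {ε ε' : ℝ} {ζ z : Fin T → Fin (nL + 1)} (hagree : AgreesUpTo ε ζ z)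
    (hle : ε ≤ ε') : AgreesUpTo ε' ζ z :=
  fun i => ⟨(hagree i).1, (sub_le_sub_left hle 1).trans (hagree i).2⟩

lemma AgreesUpTo.crossCount_div_trueCount_le {ε : ℝ} {ζ z : Fin T → Fin (nL + 1)}
    (hagree : AgreesUpTo ε ζ z) {i k : Fin (nL + 1)} (hki : k ≠ i) :
    (crossCount ζ z i k : ℝ) / trueCount ζ i ≤ ε := by
  obtain ⟨hpos, hdiag⟩ := hagree i
  have hpos' : (0 : ℝ) < trueCount ζ i := by exact_mod_cast hpos
  have hadd : (crossCount ζ z i k + crossCount ζ z i i : ℝ) ≤ trueCount ζ i := by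
    exact_mod_cast crossCount_add_crossCount_le ζ z hki
  rw [le_div_iff₀ hpos'] at hdiag
  rw [div_le_iff₀ hpos']
  linarith

lemma IsProfileMLE.agreesUpTo {g : Fin T → Fin n → Bool} {ζ z : Fin T → Fin (nL + 1)}
    (hz : IsProfileMLE h g z) (hA : A ∈ paramSpace h) (hL : 2 ≤ nL) {ε a Δ : ℝ}
    (hε : 0 < ε) (hε1 : ε ≤ 1) (ha : 0 < a) (hΔ : 0 < Δ)
    (hsep : ∀ i i', i ≠ i' → Δ ≤ ∑ j, (A i j - A i' j) ^ 2)
    (habs : ∀ i (k : Fin nL), i ≠ k.succ → a / 2 < absentCount ζ g i (Fin.castLE h k))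
    (hlik : ∀ M ∈ fittedMeans (Fin T) (Fin (nL + 1)) (Fin n),
      ε * a * Δ / (4 * nL) < sqDist M (fun t => A (ζ t)) → lik M g < lik (fun t => A (ζ t)) g) :
    AgreesUpTo ε ζ z := by
  have hτ : nL * (ε * a / (2 * nL)) = ε * (a / 2) := by field_simp
  intro i
  obtain ⟨k, hik⟩ := exists_succ_ne hL i
  have htrue : a / 2 < trueCount ζ i :=
    (habs i k hik).trans_le (by exact_mod_cast absentCount_le_trueCount ζ g i (Fin.castLE h k))
  have hpos : 0 < trueCount ζ i := by exact_mod_cast (half_pos ha).trans htrue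
  refine ⟨hpos, one_sub_le_crossCount_div_trueCount (τ := ε * a / (2 * nL)) (fun k hk => ?_)
    hpos ?_⟩
  · refine hz.crossCount_le hA hL hΔ hsep (fun i k hik => ?_) (fun M hM hlt => ?_) hk
    · rw [hτ]
      exact (mul_le_of_le_one_left (half_pos ha).le hε1).trans_lt (habs i k hik)
    · refine hlik M hM (hlt.trans_eq' ?_)
      field_simp
      ring
  · rw [hτ]
    gcongr

variable {Ω : Type*} [MeasurableSpace Ω] {μ : Measure Ω} [IsFiniteMeasure μ]
  {ρ : Fin (nL + 1) → ℝ} {zs : Ω → Fin T → Fin (nL + 1)} {G : Ω → Fin T → Fin n → Bool}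

lemma IsHubNullModel.measureReal_exists_absentCount_le (hM : IsHubNullModel μ ρ A zs G)
    (hρ : ∀ i, 0 ≤ ρ i) (hρsum : ∑ i, ρ i = 1) (hA : ∀ i j, A i j ∈ Set.Icc (0 : ℝ) 1)
    {a : ℝ} (ha : ∀ i (k : Fin nL), i ≠ k.succ → a ≤ T * (ρ i * (1 - A i (Fin.castLE h k)))) :
    μ.real {ω | ∃ i, ∃ k : Fin nL, i ≠ k.succ ∧
      (absentCount (zs ω) (G ω) i (Fin.castLE h k) : ℝ) ≤ a / 2} ≤
      (nL + 1) * nL * Real.exp (-(a / 10)) := by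
  let P : Finset (Fin (nL + 1) × Fin nL) := univ.filter fun p => p.1 ≠ p.2.succ
  have hcard : (#P : ℝ) ≤ (nL + 1) * nL := by
    refine (Nat.cast_le.2 (card_le_univ P)).trans_eq ?_
    simp
  calc _ ≤ μ.real (⋃ p ∈ P,
          {ω | (absentCount (zs ω) (G ω) p.1 (Fin.castLE h p.2) : ℝ) ≤ a / 2}) := by
        refine measureReal_mono ?_ (measure_ne_top _ _)
        rintro ω ⟨i, k, hik, hle⟩
        exact Set.mem_biUnion (x := (i, k)) (mem_filter.2 ⟨mem_univ _, hik⟩) hle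
    _ ≤ ∑ p ∈ P, Real.exp (-(a / 10)) :=
        (measureReal_biUnion_finset_le _ _).trans <| sum_le_sum fun p hp =>
          hM.measureReal_absentCount_le hρ hρsum hA (ha p.1 p.2 (mem_filter.1 hp).2)
    _ ≤ (nL + 1) * nL * Real.exp (-(a / 10)) := by
        rw [sum_const, nsmul_eq_mul]
        gcongr

/-- A bound for the probability that the estimated labels fail to satisfy `AgreesUpTo ε`. The first
term accounts for classes with at most `a / 2` groups avoiding some foreign hub, the second one for
fitted means at squared distance more than `ε * a * Δ / (4 * L)` from the true means. -/
noncomputable def errorBound (L n T : ℕ) (ε a Δ : ℝ) : ℝ :=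
  (L + 1) * L * Real.exp (-(a / 10)) +
    (L + 1) ^ T * (T + 1) ^ (2 * (L + 1) * n) * Real.exp (-(ε * a * Δ / (16 * L)))

theorem IsHubNullModel.measureReal_not_agreesUpTo_le (hM : IsHubNullModel μ ρ A zs G)
    (hρ : ∀ i, 0 ≤ ρ i) (hρsum : ∑ i, ρ i = 1) (hA : A ∈ paramSpace h) (hL : 2 ≤ nL)
    {zhat : Ω → Fin T → Fin (nL + 1)} (hzhat : ∀ᵐ ω ∂μ, IsProfileMLE h (G ω) (zhat ω))
    {ε a Δ : ℝ} (hε : 0 < ε) (hε1 : ε ≤ 1) (ha : 0 < a) (hΔ : 0 < Δ)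
    (habs : ∀ i (k : Fin nL), i ≠ k.succ → a ≤ T * (ρ i * (1 - A i (Fin.castLE h k))))
    (hsep : ∀ i i', i ≠ i' → Δ ≤ ∑ j, (A i j - A i' j) ^ 2) :
    μ.real {ω | ¬AgreesUpTo ε (zs ω) (zhat ω)} ≤ errorBound nL n T ε a Δ := by
  let absent : Set Ω := {ω | ∃ i, ∃ k : Fin nL, i ≠ k.succ ∧
    (absentCount (zs ω) (G ω) i (Fin.castLE h k) : ℝ) ≤ a / 2}
  let misfit : Set Ω := {ω | ∃ M ∈ fittedMeans (Fin T) (Fin (nL + 1)) (Fin n),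
    ε * a * Δ / (4 * nL) < sqDist M (fun t => A (zs ω t)) ∧
      lik (fun t => A (zs ω t)) (G ω) ≤ lik M (G ω)}
  have hsub : {ω | ¬AgreesUpTo ε (zs ω) (zhat ω)} ⊆
      {ω | ¬IsProfileMLE h (G ω) (zhat ω)} ∪ (absent ∪ misfit) := by
    intro ω hω
    by_contra hgood
    simp only [absent, misfit, Set.mem_union, Set.mem_ofPred_eq, not_or, not_not, not_exists,
      not_and, not_le] at hgood
    obtain ⟨hz, habs, hmisfit⟩ := hgood
    exact hω (hz.agreesUpTo hA hL hε hε1 ha hΔ hsep habs hmisfit)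
  have hcard : (#(fittedMeans (Fin T) (Fin (nL + 1)) (Fin n)) : ℝ) ≤
      (nL + 1) ^ T * (T + 1) ^ (2 * (nL + 1) * n) := by
    have hle := card_fittedMeans_le (ι := Fin T) (K := Fin (nL + 1)) (κ := Fin n)
    simp only [Fintype.card_fin] at hle
    exact_mod_cast hle
  calc μ.real {ω | ¬AgreesUpTo ε (zs ω) (zhat ω)}
      ≤ μ.real {ω | ¬IsProfileMLE h (G ω) (zhat ω)} + (μ.real absent + μ.real misfit) :=
        (measureReal_mono hsub (measure_ne_top _ _)).trans <|
          (measureReal_union_le _ _).trans (by gcongr; exact measureReal_union_le _ _)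
    _ = μ.real absent + μ.real misfit := by
        rw [(measureReal_eq_zero_iff (measure_ne_top _ _)).2 (ae_iff.1 hzhat), zero_add]
    _ ≤ (nL + 1) * nL * Real.exp (-(a / 10)) +
          #(fittedMeans (Fin T) (Fin (nL + 1)) (Fin n)) *
            Real.exp (-(ε * a * Δ / (4 * nL) / 4)) :=
        add_le_add (hM.measureReal_exists_absentCount_le hρ hρsum hA.1 habs)
          (hM.measureReal_exists_lik_le hρ hρsum hA.1
            (fun M hMmem => mem_Icc_of_mem_fittedMeans hMmem) _)
    _ ≤ _ := by
        rw [errorBound, div_div, mul_right_comm 4 (nL : ℝ) 4, show (4 * 4 : ℝ) = 16 by norm_num]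
        gcongr

end FiniteSample

section Asymptotics

lemma eventually_mul_log_add_one_le {x y : ℕ → ℝ} {N : ℕ → ℕ} (hx : ∀ m, 0 ≤ x m)
    (hy : ∀ᶠ m in atTop, 0 < y m) (hN : Tendsto N atTop atTop)
    (h : Tendsto (fun m => x m * Real.log (N m) / y m) atTop (𝓝 0)) {C : ℝ} (hC : 0 < C) :
    ∀ᶠ m in atTop, C * (x m * Real.log (N m + 1)) ≤ y m := by
  filter_upwards [hy, hN.eventually_ge_atTop 2, h.eventually_le_const (u := (2 * C)⁻¹)
    (by positivity)] with m hym hNm hm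
  have hN2 : (2 : ℝ) ≤ N m := by exact_mod_cast hNm
  have hlog : Real.log (N m + 1) ≤ 2 * Real.log (N m) :=
    calc Real.log (N m + 1) ≤ Real.log ((N m : ℝ) ^ 2) :=
          Real.log_le_log (by positivity) (by nlinarith)
      _ = 2 * Real.log (N m) := by rw [Real.log_pow, Nat.cast_ofNat]
  rw [div_le_iff₀ hym, ← div_eq_inv_mul, le_div_iff₀ (by positivity)] at hm
  calc C * (x m * Real.log (N m + 1)) ≤ C * (x m * (2 * Real.log (N m))) := by
        gcongr
        exact hx m
    _ = x m * Real.log (N m) * (2 * C) := by ring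
    _ ≤ y m := hm

lemma mul_log_add_one_le_of_le {C Δ : ℝ} {L n T : ℕ} (hC : 2 ≤ C) (hL : 1 ≤ L) (hT : 1 ≤ T)
    (hΔ : 0 < Δ) (hΔn : Δ ≤ n)
    (h : C * ((L : ℝ) ^ 3 * n * Real.log (T + 1)) ≤ Δ * T) :
    C * (L * Real.log (L + 1)) ≤ T := by
  have hL1 : (1 : ℝ) ≤ L := by exact_mod_cast hL
  have hT1 : (1 : ℝ) ≤ T := by exact_mod_cast hT
  have hn : (0 : ℝ) < n := hΔ.trans_le hΔn
  have hlogT : 1 / 2 ≤ Real.log (T + 1) :=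
    calc (1 / 2 : ℝ) ≤ Real.log 2 := by linarith [Real.log_two_gt_d9]
      _ ≤ Real.log (T + 1) := Real.log_le_log two_pos (by linarith)
  have hlinear : C * (L * Real.log (T + 1)) ≤ T := by
    refine le_of_mul_le_mul_left ?_ hn
    calc n * (C * (L * Real.log (T + 1))) = C * ((L : ℝ) ^ 1 * n * Real.log (T + 1)) := by ring
      _ ≤ C * ((L : ℝ) ^ 3 * n * Real.log (T + 1)) := by
        gcongr
        norm_num
      _ ≤ n * T := h.trans (by gcongr)
  have hLT : (L : ℝ) ≤ T :=
    calc (L : ℝ) = 2 * (L * (1 / 2)) := by ring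
      _ ≤ C * (L * Real.log (T + 1)) := by gcongr
      _ ≤ T := hlinear
  exact hlinear.trans' (by gcongr)

lemma mul_exp_neg_le_inv {L : ℕ} {s : ℝ} (hs : 3 * Real.log (L + 1) ≤ s) :
    (L + 1) * L * Real.exp (-s) ≤ ((L : ℝ) + 1)⁻¹ := by
  have hexp : Real.exp (-s) ≤ (((L : ℝ) + 1) ^ 3)⁻¹ := by
    rw [← Real.exp_log (by positivity : (0 : ℝ) < ((L : ℝ) + 1) ^ 3), ← Real.exp_neg,
      Real.exp_le_exp, Real.log_pow]
    exact neg_le_neg hs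
  calc (L + 1) * L * Real.exp (-s) ≤ (L + 1) * (L + 1) * (((L : ℝ) + 1) ^ 3)⁻¹ := by
        gcongr
        linarith
    _ = ((L : ℝ) + 1)⁻¹ := by field_simp

lemma pow_mul_pow_mul_exp_neg_le_inv {L n T : ℕ} {s : ℝ} (hT : 1 ≤ T)
    (hL : 3 * (T * Real.log (L + 1)) ≤ s)
    (hn : 3 * (2 * (L + 1) * n * Real.log (T + 1)) ≤ s) :
    ((L : ℝ) + 1) ^ T * ((T : ℝ) + 1) ^ (2 * (L + 1) * n) * Real.exp (-s) ≤ ((L : ℝ) + 1)⁻¹ := by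
  have hpow (x : ℕ) (k : ℕ) : ((x : ℝ) + 1) ^ k = Real.exp (k * Real.log (x + 1)) := by
    rw [← Real.log_pow, Real.exp_log (by positivity)]
  have hlog : Real.log (L + 1) ≤ T * Real.log (L + 1) :=
    le_mul_of_one_le_left (Real.log_nonneg (by simp)) (by exact_mod_cast hT)
  rw [hpow, hpow, ← Real.exp_add, ← Real.exp_add, ← Real.exp_log (by positivity : 0 < (L : ℝ) + 1),
    ← Real.exp_neg, Real.exp_le_exp, Real.exp_log (by positivity)]
  push_cast
  linarith

lemma errorBound_le {L n T : ℕ} {Δ c ε : ℝ} (hc : 0 < c) (hε : 0 < ε) (hL : 1 ≤ L) (hT : 1 ≤ T)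
    (habsent : 30 / c * (L * Real.log (L + 1)) ≤ T)
    (hlabels : 48 / (ε * c) * ((L : ℝ) ^ 2 * Real.log (L + 1)) ≤ Δ)
    (hmeans : 192 / (ε * c) * ((L : ℝ) ^ 3 * n * Real.log (T + 1)) ≤ Δ * T) :
    errorBound L n T ε (c * T / L) Δ ≤ 2 * ((L : ℝ) + 1)⁻¹ := by
  have hL1 : (1 : ℝ) ≤ L := by exact_mod_cast hL
  have hL0 : (0 : ℝ) < L := one_pos.trans_le hL1
  rw [div_mul_eq_mul_div, div_le_iff₀ (by positivity)] at habsent hlabels hmeans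
  refine (add_le_add (mul_exp_neg_le_inv ?_) (pow_mul_pow_mul_exp_neg_le_inv hT ?_ ?_)).trans_eq
    (two_mul _).symm
  · rw [div_div, le_div_iff₀ (by positivity)]
    linarith
  · rw [mul_div_assoc', div_mul_eq_mul_div, div_div, le_div_iff₀ (by positivity)]
    calc 3 * (T * Real.log (L + 1)) * (L * (16 * L))
        = T * (48 * ((L : ℝ) ^ 2 * Real.log (L + 1))) := by ring
      _ ≤ T * (Δ * (ε * c)) := by gcongr
      _ = ε * (c * T) * Δ := by ring
  · have hlog : 0 ≤ Real.log (T + 1) := Real.log_nonneg (by simp)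
    rw [mul_div_assoc', div_mul_eq_mul_div, div_div, le_div_iff₀ (by positivity)]
    calc 3 * (2 * ((L : ℝ) + 1) * n * Real.log (T + 1)) * (L * (16 * L))
        ≤ 3 * (2 * ((L : ℝ) + L) * n * Real.log (T + 1)) * (L * (16 * L)) := by gcongr
      _ = 192 * ((L : ℝ) ^ 3 * n * Real.log (T + 1)) := by ring
      _ ≤ ε * (c * T) * Δ := by linarith

lemma eventually_errorBound_le {L n T : ℕ → ℕ} {Δ : ℕ → ℝ} {c ε : ℝ} (hc : 0 < c) (hε : 0 < ε)
    (hL : Tendsto L atTop atTop) (hT : Tendsto T atTop atTop) (hΔ : ∀ᶠ m in atTop, 0 < Δ m)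
    (hΔn : ∀ᶠ m in atTop, Δ m ≤ n m)
    (hrateL : Tendsto (fun m => (L m : ℝ) ^ 2 * Real.log (L m) / Δ m) atTop (𝓝 0))
    (hrateT : Tendsto (fun m => (L m : ℝ) ^ 3 * n m * Real.log (T m) / (Δ m * T m))
      atTop (𝓝 0)) :
    ∀ᶠ m in atTop, errorBound (L m) (n m) (T m) ε (c * T m / L m) (Δ m) ≤
      2 * ((L m : ℝ) + 1)⁻¹ := by
  have hΔT : ∀ᶠ m in atTop, 0 < Δ m * T m := by
    filter_upwards [hΔ, hT.eventually_gt_atTop 0] with m hΔm hTm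
    exact mul_pos hΔm (by exact_mod_cast hTm)
  have hboundT {C : ℝ} (hC : 0 < C) :
      ∀ᶠ m in atTop, C * ((L m : ℝ) ^ 3 * n m * Real.log (T m + 1)) ≤ Δ m * T m :=
    eventually_mul_log_add_one_le (fun m => by positivity) hΔT hT hrateT hC
  filter_upwards [hΔ, hΔn, hL.eventually_ge_atTop 1, hT.eventually_ge_atTop 1,
    eventually_mul_log_add_one_le (fun m => by positivity) hΔ hL hrateL
      (by positivity : 0 < 48 / (ε * c)),
    hboundT (by positivity : 0 < 192 / (ε * c)),
    hboundT (by positivity : 0 < max 2 (30 / c))] with m hΔm hΔnm hLm hTm hlabels hmeans habsent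
  have hlog : 0 ≤ Real.log (L m + 1) := Real.log_nonneg (by simp)
  refine errorBound_le hc hε hLm hTm ?_ hlabels hmeans
  calc 30 / c * (L m * Real.log (L m + 1)) ≤ max 2 (30 / c) * (L m * Real.log (L m + 1)) := by
        gcongr
        exact le_max_right _ _
    _ ≤ T m := mul_log_add_one_le_of_le (le_max_left _ _) hLm hTm hΔm hΔnm habsent

end Asymptotics

section Tendsto

variable {Ω : ℕ → Type*} [∀ m, MeasurableSpace (Ω m)] {μ : ∀ m, Measure (Ω m)}
  [∀ m, IsProbabilityMeasure (μ m)]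

lemma tendsto_measure_one_of_measureReal_compl_le {s : ∀ m, Set (Ω m)} {e : ℕ → ℝ}
    (he : Tendsto e atTop (𝓝 0)) (hs : ∀ᶠ m in atTop, (μ m).real (s m)ᶜ ≤ e m) :
    Tendsto (fun m => μ m (s m)) atTop (𝓝 1) := by
  have hlower : Tendsto (fun m => 1 - ENNReal.ofReal (e m)) atTop (𝓝 1) := by
    simpa using ENNReal.Tendsto.sub tendsto_const_nhds (ENNReal.tendsto_ofReal he)
      (Or.inl ENNReal.one_ne_top)
  refine tendsto_of_tendsto_of_tendsto_of_le_of_le' hlower tendsto_const_nhds ?_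
    (Eventually.of_forall fun m => prob_le_one)
  filter_upwards [hs] with m hm
  rw [tsub_le_iff_right]
  calc 1 = μ m (s m ∪ (s m)ᶜ) := by rw [Set.union_compl_self, measure_univ]
    _ ≤ μ m (s m) + μ m (s m)ᶜ := measure_union_le _ _
    _ ≤ μ m (s m) + ENNReal.ofReal (e m) := by
        gcongr
        rw [← ofReal_measureReal]
        gcongr

lemma tendsto_measure_one_of_subset {s t : ∀ m, Set (Ω m)} (hst : ∀ m, s m ⊆ t m)
    (hs : Tendsto (fun m => μ m (s m)) atTop (𝓝 1)) :
    Tendsto (fun m => μ m (t m)) atTop (𝓝 1) :=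
  tendsto_of_tendsto_of_tendsto_of_le_of_le hs tendsto_const_nhds
    (fun m => measure_mono (hst m)) fun _ => prob_le_one

end Tendsto

section Separation

variable {nL n : ℕ} {A : Fin (nL + 1) → Fin n → ℝ}

lemma sum_sq_sub_le_card {κ : Type*} [Fintype κ] {p q : κ → ℝ}
    (hp : ∀ j, p j ∈ Set.Icc (0 : ℝ) 1) (hq : ∀ j, q j ∈ Set.Icc (0 : ℝ) 1) :
    ∑ j, (p j - q j) ^ 2 ≤ Fintype.card κ := by
  have hsq (j : κ) : (p j - q j) ^ 2 ≤ 1 := by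
    have hp := hp j
    have hq := hq j
    rw [sq_le_one_iff_abs_le_one, abs_le]
    constructor <;> linarith [hp.1, hp.2, hq.1, hq.2]
  simpa using sum_le_card_nsmul univ _ 1 fun j _ => hsq j

lemma sq_mul_le_sum_sq_sub {d c : ℝ} (hd : 0 ≤ d) {V : Fin nL → Finset (Fin n)}
    (hV : ∀ i, c ≤ #(V i))
    (hsep : ∀ (i : Fin nL) (i' : Fin (nL + 1)), i' ≠ i.succ → ∀ j ∈ V i, d ≤ A i.succ j - A i' j)
    {i i' : Fin (nL + 1)} (hne : i ≠ i') : d ^ 2 * c ≤ ∑ j, (A i j - A i' j) ^ 2 := by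
  have hleader (k : Fin nL) (i' : Fin (nL + 1)) (hk : i' ≠ k.succ) :
      d ^ 2 * c ≤ ∑ j, (A k.succ j - A i' j) ^ 2 :=
    calc d ^ 2 * c ≤ #(V k) • d ^ 2 := by
          rw [nsmul_eq_mul, mul_comm]
          gcongr
          exact hV k
      _ ≤ ∑ j ∈ V k, (A k.succ j - A i' j) ^ 2 :=
          card_nsmul_le_sum _ _ _ fun j hj => pow_le_pow_left₀ hd (hsep k i' hk j hj) 2
      _ ≤ ∑ j, (A k.succ j - A i' j) ^ 2 := sum_le_univ_sum_of_nonneg fun j => sq_nonneg _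
  rcases eq_or_ne i 0 with rfl | hi
  · obtain ⟨k, rfl⟩ := Fin.exists_succ_eq.2 hne.symm
    simpa only [sub_sq_comm] using hleader k 0 hne
  · obtain ⟨k, rfl⟩ := Fin.exists_succ_eq.2 hi
    exact hleader k i' hne.symm

end Separation

section Rates

lemma sq_mul_log_div_le {L n d v : ℝ} (hL : 1 ≤ L) (hn : 0 < n) (hd : 0 < d) (hv : 0 < v)
    (hdv : d ^ 2 * (v * n / L) ≤ n) :
    L ^ 2 * Real.log L / (d ^ 2 * (v * n / L)) ≤
      L ^ 8 * Real.log L / (d ^ 4 * v ^ 2 * n) := by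
  have hL0 : 0 < L := one_pos.trans_le hL
  have hlog : 0 ≤ Real.log L := Real.log_nonneg hL
  have hle : d ^ 2 * v ≤ L := by
    rw [← mul_div_assoc, ← mul_assoc, div_le_iff₀ hL0, mul_comm n] at hdv
    exact le_of_mul_le_mul_right hdv hn
  calc L ^ 2 * Real.log L / (d ^ 2 * (v * n / L))
      = L ^ 3 * (d ^ 2 * v) * Real.log L / (d ^ 4 * v ^ 2 * n) := by field_simp
    _ ≤ L ^ 3 * L ^ 5 * Real.log L / (d ^ 4 * v ^ 2 * n) := by
        gcongr
        exact hle.trans (le_self_pow₀ hL (by norm_num))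
    _ = L ^ 8 * Real.log L / (d ^ 4 * v ^ 2 * n) := by ring

lemma pow_three_mul_log_div_le {L n T d v : ℝ} (hL : 1 ≤ L) (hn : 0 < n) (hT : 1 ≤ T)
    (hd : 0 < d) (hv : 0 < v) :
    L ^ 3 * n * Real.log T / (d ^ 2 * (v * n / L) * T) ≤
      L ^ 5 * Real.log T / (d ^ 2 * v * T) := by
  have hlog : 0 ≤ Real.log T := Real.log_nonneg hT
  calc L ^ 3 * n * Real.log T / (d ^ 2 * (v * n / L) * T)
      = L ^ 4 * Real.log T / (d ^ 2 * v * T) := by field_simp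
    _ ≤ L ^ 5 * Real.log T / (d ^ 2 * v * T) := by
        gcongr
        norm_num

variable {nL n T : ℕ → ℕ} {d v : ℕ → ℝ}

lemma eventually_one_le_natCast {N : ℕ → ℕ} (hN : Tendsto N atTop atTop) :
    ∀ᶠ m in atTop, (1 : ℝ) ≤ N m := by
  filter_upwards [hN.eventually_ge_atTop 1] with m hm
  exact_mod_cast hm

lemma tendsto_sq_mul_log_div (hnL : Tendsto nL atTop atTop) (hn : Tendsto n atTop atTop)
    (hd : ∀ m, 0 < d m) (hv : ∀ m, 0 < v m)
    (hdv : ∀ᶠ m in atTop, d m ^ 2 * (v m * n m / nL m) ≤ n m)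
    (hrate : Tendsto (fun m => (nL m : ℝ) ^ 8 * Real.log (nL m) / (d m ^ 4 * v m ^ 2 * n m))
      atTop (𝓝 0)) :
    Tendsto (fun m => (nL m : ℝ) ^ 2 * Real.log (nL m) / (d m ^ 2 * (v m * n m / nL m)))
      atTop (𝓝 0) := by
  refine squeeze_zero' ?_ ?_ hrate
  · filter_upwards with m
    have := (hv m).le
    have := Real.log_natCast_nonneg (nL m)
    positivity
  · filter_upwards [eventually_one_le_natCast hnL, eventually_one_le_natCast hn, hdv]
      with m hLm hnm hdvm
    exact sq_mul_log_div_le hLm (one_pos.trans_le hnm) (hd m) (hv m) hdvm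

lemma tendsto_pow_three_mul_log_div (hnL : Tendsto nL atTop atTop) (hn : Tendsto n atTop atTop)
    (hT : Tendsto T atTop atTop) (hd : ∀ m, 0 < d m) (hv : ∀ m, 0 < v m)
    (hrate : Tendsto (fun m => (nL m : ℝ) ^ 5 * Real.log (T m) / (d m ^ 2 * v m * T m))
      atTop (𝓝 0)) :
    Tendsto (fun m => (nL m : ℝ) ^ 3 * n m * Real.log (T m) /
      (d m ^ 2 * (v m * n m / nL m) * T m)) atTop (𝓝 0) := by
  refine squeeze_zero' ?_ ?_ hrate
  · filter_upwards with m
    have := (hv m).le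
    have := Real.log_natCast_nonneg (T m)
    positivity
  · filter_upwards [eventually_one_le_natCast hnL, eventually_one_le_natCast hn,
      eventually_one_le_natCast hT] with m hLm hnm hTm
    exact pow_three_mul_log_div_le hLm (one_pos.trans_le hnm) hTm (hd m) (hv m)

lemma eventually_sq_mul_pos (hnL : Tendsto nL atTop atTop) (hn : Tendsto n atTop atTop)
    (hd : ∀ m, 0 < d m) (hv : ∀ m, 0 < v m) :
    ∀ᶠ m in atTop, 0 < d m ^ 2 * (v m * n m / nL m) := by
  filter_upwards [hnL.eventually_gt_atTop 0, hn.eventually_gt_atTop 0] with m hLm hnm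
  have := hd m
  have := hv m
  positivity

lemma eventually_le_card_of_forall_le_sum_sq_sub (hnL : Tendsto nL atTop atTop)
    {A : ∀ m, Fin (nL m + 1) → Fin (n m) → ℝ} (hA : ∀ m i j, A m i j ∈ Set.Icc (0 : ℝ) 1)
    {Δ : ℕ → ℝ} (hsep : ∀ m i i', i ≠ i' → Δ m ≤ ∑ j, (A m i j - A m i' j) ^ 2) :
    ∀ᶠ m in atTop, Δ m ≤ n m := by
  filter_upwards [hnL.eventually_ge_atTop 1] with m hL
  have hne : (0 : Fin (nL m + 1)) ≠ Fin.succ ⟨0, hL⟩ := (Fin.succ_ne_zero _).symm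
  simpa using (hsep m _ _ hne).trans (sum_sq_sub_le_card (hA m _) (hA m _))

lemma eventually_forall_le_half (hle : ∀ m, nL m ≤ n m) (hnL : Tendsto nL atTop atTop)
    {A : ∀ m, Fin (nL m + 1) → Fin (n m) → ℝ} {c : ℝ}
    (hA : ∀ m (i : Fin (nL m + 1)) (k : Fin (nL m)), i ≠ k.succ →
      A m i (Fin.castLE (hle m) k) ≤ c / nL m) :
    ∀ᶠ m in atTop, ∀ i (k : Fin (nL m)), i ≠ k.succ →
      A m i (Fin.castLE (hle m) k) ≤ 1 - 1 / 2 := by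
  filter_upwards [((tendsto_natCast_atTop_atTop.comp hnL).const_div_atTop c).eventually_le_const
    one_half_pos] with m hm i k hik
  exact (hA m i k hik).trans (hm.trans_eq (sub_half 1).symm)

end Rates

section Consistency

theorem tendsto_measure_agreesUpTo {nL n T : ℕ → ℕ} {hle : ∀ m, nL m ≤ n m}
    (hnL : Tendsto nL atTop atTop) (hT : Tendsto T atTop atTop)
    {ρ : ∀ m, Fin (nL m + 1) → ℝ} (hρ : ∀ m, ∑ i, ρ m i = 1)
    {cmin : ℝ} (hcmin : 0 < cmin) (hρmin : ∀ m i, cmin / nL m ≤ ρ m i)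
    {A : ∀ m, Fin (nL m + 1) → Fin (n m) → ℝ} (hA : ∀ m, A m ∈ paramSpace (hle m))
    {Δ : ℕ → ℝ} (hΔ : ∀ᶠ m in atTop, 0 < Δ m)
    (hsep : ∀ m i i', i ≠ i' → Δ m ≤ ∑ j, (A m i j - A m i' j) ^ 2)
    {δ : ℝ} (hδ : 0 < δ)
    (hhub : ∀ᶠ m in atTop, ∀ i (k : Fin (nL m)), i ≠ k.succ →
      A m i (Fin.castLE (hle m) k) ≤ 1 - δ)
    (hrateL : Tendsto (fun m => (nL m : ℝ) ^ 2 * Real.log (nL m) / Δ m) atTop (𝓝 0))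
    (hrateT : Tendsto (fun m => (nL m : ℝ) ^ 3 * n m * Real.log (T m) / (Δ m * T m))
      atTop (𝓝 0))
    {Ω : ℕ → Type*} [∀ m, MeasurableSpace (Ω m)]
    {μ : ∀ m, Measure (Ω m)} [∀ m, IsProbabilityMeasure (μ m)]
    {zs : ∀ m, Ω m → Fin (T m) → Fin (nL m + 1)}
    {G : ∀ m, Ω m → Fin (T m) → Fin (n m) → Bool}
    (hmodel : ∀ m, IsHubNullModel (μ m) (ρ m) (A m) (zs m) (G m))
    {zhat : ∀ m, Ω m → Fin (T m) → Fin (nL m + 1)}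
    (hzhat : ∀ m, ∀ᵐ ω ∂(μ m), IsProfileMLE (hle m) (G m ω) (zhat m ω))
    {η : ℝ} (hη : 0 < η) :
    Tendsto (fun m => μ m {ω | AgreesUpTo η (zs m ω) (zhat m ω)}) atTop (𝓝 1) := by
  have hε : 0 < min 1 η := lt_min one_pos hη
  have hΔn := eventually_le_card_of_forall_le_sum_sq_sub hnL (fun m => (hA m).1) hsep
  have herror : Tendsto (fun m => 2 * ((nL m : ℝ) + 1)⁻¹) atTop (𝓝 0) := by
    simpa using (tendsto_inv_atTop_zero.comp (tendsto_atTop_add_const_right _ 1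
      (tendsto_natCast_atTop_atTop.comp hnL))).const_mul (2 : ℝ)
  refine tendsto_measure_one_of_measureReal_compl_le herror ?_
  filter_upwards [eventually_errorBound_le (mul_pos hcmin hδ) hε hnL hT hΔ hΔn hrateL hrateT, hΔ,
    hhub, hnL.eventually_ge_atTop 2, hT.eventually_gt_atTop 0] with m herr hΔm hhubm hLm hTm
  have hρ0 (i : Fin (nL m + 1)) : 0 ≤ ρ m i := (hρmin m i).trans' (by positivity)
  have habs (i : Fin (nL m + 1)) (k : Fin (nL m)) (hik : i ≠ k.succ) :
      cmin * δ * T m / nL m ≤ T m * (ρ m i * (1 - A m i (Fin.castLE (hle m) k))) :=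
    calc cmin * δ * T m / nL m = T m * (cmin / nL m * δ) := by ring
      _ ≤ T m * (ρ m i * (1 - A m i (Fin.castLE (hle m) k))) := by
        gcongr
        · exact hρ0 i
        · exact hρmin m i
        · linarith [hhubm i k hik]
  calc (μ m).real {ω | AgreesUpTo η (zs m ω) (zhat m ω)}ᶜ
      ≤ (μ m).real {ω | ¬AgreesUpTo (min 1 η) (zs m ω) (zhat m ω)} :=
        measureReal_mono (fun ω hω hagree => hω (hagree.mono (min_le_right 1 η)))
          (measure_ne_top _ _)
    _ ≤ _ := (hmodel m).measureReal_not_agreesUpTo_le hρ0 (hρ m) (hA m) hLm (hzhat m) hε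
        (min_le_left 1 η) (by positivity) hΔm habs (hsep m)
    _ ≤ _ := herr

end Consistency

end HubModel

open Filter MeasureTheory HubModel in
theorem theorem8_general (nL n T : ℕ → ℕ) (hle : ∀ m, nL m ≤ n m)
    (hnL : Tendsto nL atTop atTop) (hn : Tendsto n atTop atTop) (hT : Tendsto T atTop atTop)
    (ρ : ∀ m, Fin (nL m + 1) → ℝ) (hρ : ∀ m, ∑ i, ρ m i = 1)
    (cmin : ℝ) (hcmin : 0 < cmin) (hρmin : ∀ m i, cmin / nL m ≤ ρ m i)
    (A : ∀ m, Matrix (Fin (nL m + 1)) (Fin (n m)) ℝ) (hA : ∀ m, A m ∈ paramSpace (hle m))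
    (d v : ℕ → ℝ) (hd : ∀ m, 0 < d m) (hv : ∀ m, 0 < v m)
    (V : ∀ m, Fin (nL m) → Finset (Fin (n m)))
    (hVcard : ∀ m i, v m * n m / nL m ≤ ((V m i).card : ℝ))
    (hVsep : ∀ m (i : Fin (nL m)) (i' : Fin (nL m + 1)), i' ≠ i.succ →
      ∀ j ∈ V m i, d m ≤ A m i.succ j - A m i' j)
    (δ : ℝ) (hδ : 0 < δ)
    (hhub : ∀ᶠ m in atTop, ∀ i (k : Fin (nL m)), i ≠ k.succ →
      A m i (Fin.castLE (hle m) k) ≤ 1 - δ)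
    (hrate₂ : Tendsto (fun m => (nL m : ℝ) ^ 5 * Real.log (T m) / (d m ^ 2 * v m * (T m : ℝ)))
      atTop (nhds 0))
    (hrate₃ : Tendsto
      (fun m => (nL m : ℝ) ^ 8 * Real.log (nL m) / (d m ^ 4 * v m ^ 2 * (n m : ℝ)))
      atTop (nhds 0))
    (Ω : ℕ → Type*) [∀ m, MeasurableSpace (Ω m)]
    (μ : ∀ m, Measure (Ω m)) [∀ m, IsProbabilityMeasure (μ m)]
    (zs : ∀ m, Ω m → Fin (T m) → Fin (nL m + 1))
    (G : ∀ m, Ω m → Fin (T m) → Fin (n m) → Bool)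
    (hmodel : ∀ m, IsHubNullModel (μ m) (ρ m) (A m) (zs m) (G m))
    (zhat : ∀ m, Ω m → Fin (T m) → Fin (nL m + 1))
    (hzhat : ∀ m, ∀ᵐ ω ∂(μ m), IsProfileMLE (hle m) (G m ω) (zhat m ω))
    (η : ℝ) (hη : 0 < η) :
    Tendsto (fun m => μ m {ω | AgreesUpTo η (zs m ω) (zhat m ω)}) atTop (nhds 1) := by
  have hsep (m : ℕ) (i i' : Fin (nL m + 1)) (hne : i ≠ i') :
      d m ^ 2 * (v m * n m / nL m) ≤ ∑ j, (A m i j - A m i' j) ^ 2 :=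
    sq_mul_le_sum_sq_sub (hd m).le (hVcard m) (hVsep m) hne
  have hdv := eventually_le_card_of_forall_le_sum_sq_sub hnL (fun m => (hA m).1) hsep
  exact tendsto_measure_agreesUpTo hnL hT hρ hcmin hρmin hA
    (eventually_sq_mul_pos hnL hn hd hv) hsep hδ hhub
    (tendsto_sq_mul_log_div hnL hn hd hv hdv hrate₃)
    (tendsto_pow_three_mul_log_div hnL hn hT hd hv hrate₂) hmodel hzhat hη

theorem theorem8
    -- the sizes of the hub set, of the node set and of the sample
    (nL n T : ℕ → ℕ) (hle : ∀ m, nL m ≤ n m)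
    (hnL : Filter.Tendsto nL Filter.atTop Filter.atTop)
    (hn : Filter.Tendsto n Filter.atTop Filter.atTop)
    (hT : Filter.Tendsto T Filter.atTop Filter.atTop)
    -- the parameters
    (ρ : ∀ m, Fin (nL m + 1) → ℝ) (hρ : ∀ m, ∑ i, ρ m i = 1)
    (cmin cmax : ℝ) (hcmin : 0 < cmin) (hcmax : 0 < cmax)
    (hρmin : ∀ m i, cmin / nL m ≤ ρ m i) (hρmax : ∀ m i, ρ m i ≤ cmax / nL m)
    (A : ∀ m, Matrix (Fin (nL m + 1)) (Fin (n m)) ℝ)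
    (hA : ∀ m, A m ∈ HubModel.paramSpace (hle m))
    -- condition (i)
    (d v : ℕ → ℝ) (hd : ∀ m, 0 < d m) (hv : ∀ m, 0 < v m)
    (V : ∀ m, Fin (nL m) → Finset (Fin (n m)))
    (hVcard : ∀ m i, v m * n m / nL m ≤ ((V m i).card : ℝ))
    (hVsep : ∀ m (i : Fin (nL m)) (i' : Fin (nL m + 1)), i' ≠ i.succ →
      ∀ j ∈ V m i, d m ≤ A m i.succ j - A m i' j)
    -- condition (ii)
    (c₀ : ℝ) (hc₀ : 0 < c₀)
    (hAub : ∀ m (i : Fin (nL m + 1)) (i' : Fin (nL m)), i ≠ i'.succ →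
      A m i (Fin.castLE (hle m) i') ≤ c₀ / nL m)
    -- the rates
    (hrate₁ : Filter.Tendsto (fun m => (nL m : ℝ) ^ 2 * Real.log (nL m) / (T m : ℝ))
      Filter.atTop (nhds 0))
    (hrate₂ : Filter.Tendsto
      (fun m => (nL m : ℝ) ^ 5 * Real.log (T m) / (d m ^ 2 * v m * (T m : ℝ)))
      Filter.atTop (nhds 0))
    (hrate₃ : Filter.Tendsto
      (fun m => (nL m : ℝ) ^ 8 * Real.log (nL m) / (d m ^ 4 * v m ^ 2 * (n m : ℝ)))
      Filter.atTop (nhds 0))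
    -- true labels, data, and a maximum profile likelihood estimator
    (Ω : ℕ → Type*) [∀ m, MeasurableSpace (Ω m)]
    (μ : ∀ m, MeasureTheory.Measure (Ω m)) [∀ m, MeasureTheory.IsProbabilityMeasure (μ m)]
    (zs : ∀ m, Ω m → Fin (T m) → Fin (nL m + 1))
    (G : ∀ m, Ω m → Fin (T m) → Fin (n m) → Bool)
    (hmodel : ∀ m, HubModel.IsHubNullModel (μ m) (ρ m) (A m) (zs m) (G m))
    (zhat : ∀ m, Ω m → Fin (T m) → Fin (nL m + 1))
    (hzhat_meas : ∀ m, Measurable (zhat m))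
    (hzhat : ∀ m, ∀ᵐ ω ∂(μ m), HubModel.IsProfileMLE (hle m) (G m ω) (zhat m ω))
    (η : ℝ) (hη : 0 < η) :
    Filter.Tendsto
      (fun m => μ m {ω | ∀ i : Fin (nL m),
        0 < HubModel.trueCount (zs m ω) i.succ ∧
        (HubModel.crossCount (zs m ω) (zhat m ω) i.succ 0 : ℝ) /
          (HubModel.trueCount (zs m ω) i.succ : ℝ) ≤ η})
      Filter.atTop (nhds 1) := by
  exact HubModel.tendsto_measure_one_of_subset
    (fun m ω hω i => ⟨(hω i.succ).1, hω.crossCount_div_trueCount_le (Fin.succ_ne_zero i).symm⟩)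
    (theorem8_general nL n T hle hnL hn hT ρ hρ cmin hcmin hρmin A hA d v hd hv V hVcard hVsep
      (1 / 2) one_half_pos (HubModel.eventually_forall_le_half hle hnL hAub) hrate₂ hrate₃
      Ω μ zs G hmodel zhat hzhat η hη)
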